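/- ts existence is classical and has to be proved as part of the proof./ Let $c<1$ be a real number, let $\omega_0(t)=\frac{dt}{t}$ and $\omega_1(t)=\frac{(1-c)\,dt}{(1-t)(1-ct)}$, and for $r\ge 1$ and integers $k_1,\dots,k_{r-1}\ge 1$, $k_r\ge 2$ put ts existence is classical and has to be proved as part of the proof./ $$Z_c(k_1,\dots,k_r)=\mathop{\int\cdots\int}\limits_{0<t_1<\cdots<t_k<1}\omega_{\varepsilon_1}(t_1)\cdots\omega_{\varepsilon_k}(t_k),\qquad (\varepsilon_1,\dots,\varepsilon_k)=(1,0^{k_1-1},1,0^{k_2-1},\dots,1,0^{k_r-1}),$$ ts existence is classical and has to be proved as part of the proof./ where $k=k_1+\cdots+k_r$ and $0^{j}$ stands for $j$ consecutive zeros. Let ${}_2F_1(a,b;d;z)$ be the Gauss hypergeometric function on $\mathbb{C}\setminus[1,\infty)$, that is, the analytic continuation of the Gauss series $\sum_{j\ge 0}\frac{(a)_j(b)_j}{(d)_j}\frac{z^j}{j!}$, $|z|<1$. ts existence is classical and has to be proved as part of the proof./ ts existence is classical and has to be proved as part of the proof./ Then the integrals defining $Z_c(\underbrace{1,\dots,1}_{n-1},m+1)$,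 $m,n\ge 1$, converge absolutely, and for all complex $X,Y$ with $|X|<1$, $|Y|<1$ and $X+Y\neq 1$ the following series converges absolutely and ts existence is classical and has to be proved as part of the proof./ $$1-\sum_{m,n\ge 1}Z_c(\underbrace{1,\dots,1}_{n-1},m+1)\,X^mY^n=(1-c)\,\frac{\Gamma(1-X)\Gamma(1-Y)}{\Gamma(1-X-Y)}\;{}_2F_1(1-X,1-Y;1-X-Y;c).$$ ts existence is classical and has to be proved as part of the proof./ -/

import Mathlib

open MeasureTheory Set

noncomputable section

namespace DeformedMZV

/-- The coefficient of `dt` in the differential forms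
`ω₀ = dt / t` and `ω₁ = (1 - c) dt / ((1 - t) (1 - c t))`. -/
def omega (c : ℝ) (e : Fin 2) (t : ℝ) : ℝ :=
  if e = 0 then 1 / t else (1 - c) / ((1 - t) * (1 - c * t))

/-- The open simplex `0 < t₁ < ⋯ < t_k < 1`. -/
def openSimplex (k : ℕ) : Set (Fin k → ℝ) :=
  {t | (∀ i, 0 < t i ∧ t i < 1) ∧ StrictMono t}

/-- The integrand `ω_{ε₁}(t₁) ⋯ ω_{ε_k}(t_k)` attached to a word `ε`. -/
def integrand (c : ℝ) (w : List (Fin 2)) (t : Fin w.length → ℝ) : ℝ :=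
  ∏ i, omega c (w.get i) (t i)

/-- The iterated integral
`I(ε₁, …, ε_k) = ∫⋯∫_{0 < t₁ < ⋯ < t_k < 1} ω_{ε₁}(t₁) ⋯ ω_{ε_k}(t_k)`. -/
def iteratedI (c : ℝ) (w : List (Fin 2)) : ℝ :=
  ∫ t in openSimplex w.length, integrand c w t

/-- The word `(1, 0^{k₁-1}, 1, 0^{k₂-1}, …, 1, 0^{k_r-1})` of an index `(k₁, …, k_r)`
(with all `k_i ≥ 1`). -/
def wordOf (k : List ℕ) : List (Fin 2) :=
  k.flatMap fun j => 1 :: List.replicate (j - 1) 0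

/-- `Z_c(k₁, …, k_r)`. -/
def Z (c : ℝ) (k : List ℕ) : ℝ :=
  iteratedI c (wordOf k)

/-- The complex plane cut along `[1, ∞)`. -/
def cutPlane : Set ℂ :=
  {z | z.re < 1 ∨ z.im ≠ 0}

/-- `g` is an analytic continuation to the cut plane of the Gauss series
`∑ (a)ₙ (b)ₙ / (d)ₙ zⁿ / n!`, `|z| < 1`. -/
def IsGaussContinuation (a b d : ℂ) (g : ℂ → ℂ) : Prop :=
  DifferentiableOn ℂ g cutPlane ∧
    ∀ z ∈ Metric.ball (0 : ℂ) 1, g z = ordinaryHypergeometric a b d z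

open Classical in
/-- The Gauss hypergeometric function `₂F₁(a, b; d; z)` on the cut plane (principal branch),
i.e. the analytic continuation of the Gauss series. -/
def gaussHypergeometric (a b d z : ℂ) : ℂ :=
  if h : ∃ g, IsGaussContinuation a b d g then h.choose z else 0

theorem isOpen_cutPlane : IsOpen cutPlane :=
  (isOpen_lt Complex.continuous_re continuous_const).union
    (isOpen_ne_fun Complex.continuous_im continuous_const)

theorem ball_subset_cutPlane : Metric.ball (0 : ℂ) 1 ⊆ cutPlane := by
  intro z hz
  left
  have h := Complex.re_le_norm z
  rw [mem_ball_zero_iff] at hz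
  linarith

theorem isPreconnected_cutPlane : IsPreconnected cutPlane := by
  have h0 : StarConvex ℝ (0 : ℂ) cutPlane := by
    intro y hy s t hs ht hst
    simp only [smul_zero, zero_add]
    rcases hy with hy | hy
    · left
      rw [Complex.smul_re, smul_eq_mul]
      rcases ht.eq_or_lt with h | h
      · rw [← h]; norm_num
      · nlinarith
    · rcases ht.eq_or_lt with h | h
      · left; rw [← h]; norm_num
      · right
        rw [Complex.smul_im, smul_eq_mul]
        exact mul_ne_zero h.ne' hy
  exact (h0.isPathConnected (Or.inl (by norm_num))).isConnected.isPreconnected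

/-- The continuation is unique, so the choice in `gaussHypergeometric` is immaterial. -/
theorem gaussHypergeometric_eq {a b d : ℂ} {g : ℂ → ℂ} (hg : IsGaussContinuation a b d g)
    {z : ℂ} (hz : z ∈ cutPlane) : gaussHypergeometric a b d z = g z := by
  have h : ∃ g, IsGaussContinuation a b d g := ⟨g, hg⟩
  rw [gaussHypergeometric, dif_pos h]
  obtain ⟨h1, h2⟩ := h.choose_spec
  refine (h1.analyticOnNhd isOpen_cutPlane).eqOn_of_preconnected_of_eventuallyEq
    (hg.1.analyticOnNhd isOpen_cutPlane) isPreconnected_cutPlane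
    (z₀ := 0) (Or.inl (by norm_num)) ?_ hz
  filter_upwards [Metric.ball_mem_nhds (0 : ℂ) one_pos] with w hw
  rw [h2 w hw, hg.2 w hw]

end DeformedMZV

end

/-!
Integrating out the letters before and after the last `ω₁` produces divided powers of
`L(t) = log ((1 - c t) / (1 - t))` and of `-log t`, so that
`Z_c(1, …, 1, m + 1) = ∫₀¹ ω₁(t) (-log t) ^ m / m! · L(t) ^ (n - 1) / (n - 1)!`. Summing the two
exponential series under the integral sign turns the generating function into
`(1 - c) Y ∫₀¹ (1 - t) ^ (-Y - 1) (t ^ (-X) - 1) (1 - c t) ^ (Y - 1) dt`, an Euler integral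
regularised at `t = 1`. As a function of `c` it is holomorphic in the cut plane, and its Taylor
coefficients at `0` are regularised beta integrals. Integration by parts evaluates these as
differences of two Gamma quotients: one gives the Gauss series, the other the geometric series
`(1 - c)⁻¹`, which accounts for the `1` on the left-hand side.
-/

noncomputable section

namespace DeformedMZV

open Filter
open scoped ENNReal Topology

section IteratedIntegrals

/-- The open simplex `a < t₁ < ⋯ < t_k < b`. -/
def simplex (a b : ℝ) (k : ℕ) : Set (Fin k → ℝ) :=
  {t | (∀ i, a < t i ∧ t i < b) ∧ StrictMono t}

theorem measurableSet_simplex (a b : ℝ) (k : ℕ) : MeasurableSet (simplex a b k) := by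
  simp only [simplex, StrictMono]
  measurability

theorem simplex_zero (a b : ℝ) : simplex a b 0 = univ :=
  eq_univ_of_forall fun _ => ⟨fun i => i.elim0, fun i => i.elim0⟩

theorem simplex_subset_simplex {a a' b : ℝ} (h : a ≤ a') (k : ℕ) :
    simplex a' b k ⊆ simplex a b k :=
  fun _ ht => ⟨fun i => ⟨h.trans_lt (ht.1 i).1, (ht.1 i).2⟩, ht.2⟩

theorem cons_mem_simplex {a b x : ℝ} {k : ℕ} {t : Fin k → ℝ} :
    (Fin.cons x t : Fin (k + 1) → ℝ) ∈ simplex a b (k + 1) ↔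
      x ∈ Ioo a b ∧ t ∈ simplex x b k := by
  simp only [simplex, mem_ofPred_eq, Fin.forall_fin_succ, Fin.cons_zero, Fin.cons_succ, StrictMono,
    Fin.succ_lt_succ_iff, mem_Ioo, Fin.succ_pos, forall_const, Fin.not_lt_zero,
    false_imp_iff, true_and, forall_and]
  constructor
  · rintro ⟨⟨⟨ha, -⟩, hb, htb⟩, hxt, ht⟩
    exact ⟨⟨ha, hb⟩, ⟨hxt, htb⟩, ht⟩
  · rintro ⟨⟨ha, hb⟩, ⟨hxt, htb⟩, ht⟩
    exact ⟨⟨⟨ha, fun i => ha.trans (hxt i)⟩, hb, htb⟩, hxt, ht⟩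

theorem lintegral_fin_succ {k : ℕ} {f : (Fin (k + 1) → ℝ) → ℝ≥0∞} (hf : Measurable f) :
    ∫⁻ t, f t = ∫⁻ x : ℝ, ∫⁻ t : Fin k → ℝ, f (Fin.cons x t) := by
  have hp := (volume_preserving_piFinSuccAbove (fun _ : Fin (k + 1) => ℝ) 0).symm
  rw [← hp.lintegral_comp hf, Measure.volume_eq_prod,
    lintegral_prod (fun p => f ((MeasurableEquiv.piFinSuccAbove (fun _ => ℝ) 0).symm p))
      (hf.comp hp.measurable).aemeasurable]
  refine lintegral_congr fun x => lintegral_congr fun t => congrArg f ?_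
  rw [MeasurableEquiv.piFinSuccAbove_symm_apply]
  exact Fin.insertNth_zero' x t

theorem lintegral_Ioo_lintegral_Ioo_swap {K : ℝ → ℝ → ℝ≥0∞}
    (hK : Measurable (Function.uncurry K)) (a b : ℝ) :
    ∫⁻ s in Ioo a b, ∫⁻ t in Ioo s b, K s t = ∫⁻ t in Ioo a b, ∫⁻ s in Ioo a t, K s t := by
  have inner_left (s : ℝ) (hs : s ∈ Ioo a b) : ∫⁻ t in Ioo s b, K s t =
      ∫⁻ t in Ioo a b, {p : ℝ × ℝ | p.1 < p.2}.indicator (Function.uncurry K) (s, t) := by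
    have : Ioo s b = Ioi s ∩ Ioo a b := by
      rw [inter_comm, Ioo_inter_Ioi, sup_eq_right.2 hs.1.le]
    rw [this, ← setLIntegral_indicator measurableSet_Ioi]
    rfl
  have inner_right (t : ℝ) (ht : t ∈ Ioo a b) : ∫⁻ s in Ioo a t, K s t =
      ∫⁻ s in Ioo a b, {p : ℝ × ℝ | p.1 < p.2}.indicator (Function.uncurry K) (s, t) := by
    have : Ioo a t = Iio t ∩ Ioo a b := by
      rw [inter_comm, Ioo_inter_Iio, inf_eq_right.2 ht.2.le]
    rw [this, ← setLIntegral_indicator measurableSet_Iio]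
    rfl
  rw [setLIntegral_congr_fun measurableSet_Ioo inner_left,
    setLIntegral_congr_fun measurableSet_Ioo inner_right]
  exact lintegral_lintegral_swap
    (hK.indicator (measurableSet_lt measurable_fst measurable_snd)).aemeasurable

theorem lintegral_ofReal_deriv {f F : ℝ → ℝ} {a b : ℝ} (hab : a ≤ b)
    (hF : ContinuousOn F (Icc a b)) (hd : ∀ x ∈ Ioo a b, HasDerivAt F (f x) x)
    (hf : ∀ x ∈ Ioo a b, 0 ≤ f x) :
    ∫⁻ x in Ioo a b, ENNReal.ofReal (f x) = ENNReal.ofReal (F b - F a) := by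
  have hi : IntegrableOn f (Ioc a b) :=
    intervalIntegral.integrableOn_deriv_of_nonneg hF hd hf
  rw [← intervalIntegral.integral_eq_sub_of_hasDerivAt_of_le hab hF hd
    ((intervalIntegrable_iff_integrableOn_Ioc_of_le hab).2 hi),
    intervalIntegral.integral_of_le hab, integral_Ioc_eq_integral_Ioo,
    ofReal_integral_eq_lintegral_ofReal (hi.mono_set Ioo_subset_Ioc_self)
      (ae_restrict_of_forall_mem measurableSet_Ioo hf)]

theorem lintegral_ofReal_deriv_mul_pow_div_factorial {f F : ℝ → ℝ} {a b : ℝ} (hab : a ≤ b)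
    (hF : ContinuousOn F (Icc a b)) (hd : ∀ x ∈ Ioo a b, HasDerivAt F (f x) x)
    (hf : ∀ x ∈ Ioo a b, 0 ≤ f x) (n : ℕ) :
    ∫⁻ x in Ioo a b, ENNReal.ofReal (f x) * ENNReal.ofReal ((F b - F x) ^ n / n.factorial) =
      ENNReal.ofReal ((F b - F a) ^ (n + 1) / (n + 1).factorial) := by
  have hmono : MonotoneOn F (Icc a b) := by
    refine monotoneOn_of_hasDerivWithinAt_nonneg (f' := f) (convex_Icc a b) hF ?_ ?_ <;>
      rw [interior_Icc]
    exacts [fun x hx => (hd x hx).hasDerivWithinAt, hf]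
  have hderiv (x : ℝ) (hx : x ∈ Ioo a b) : HasDerivAt
      (fun x => -((F b - F x) ^ (n + 1) / ((n + 1).factorial : ℝ)))
      (f x * ((F b - F x) ^ n / n.factorial)) x := by
    convert! ((((hd x hx).const_sub (F b)).pow (n + 1)).div_const _).neg using 1
    rw [Nat.factorial_succ]
    push_cast
    field_simp
  have hnonneg (x : ℝ) (hx : x ∈ Ioo a b) : 0 ≤ f x * ((F b - F x) ^ n / n.factorial) := by
    have := hf x hx
    have := sub_nonneg.2 (hmono (Ioo_subset_Icc_self hx) (right_mem_Icc.2 hab) hx.2.le)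
    positivity
  rw [setLIntegral_congr_fun measurableSet_Ioo fun x hx => (ENNReal.ofReal_mul (hf x hx)).symm,
    lintegral_ofReal_deriv hab (by fun_prop) hderiv hnonneg]
  simp

variable {ι : Type*} {f : ι → ℝ → ℝ≥0∞}

/-- The iterated integral `∫⋯∫_{a < t₁ < ⋯ < t_k < b} f_{w₁}(t₁) ⋯ f_{w_k}(t_k)` attached to a
word `w` in letters that index nonnegative functions `f`, as a Lebesgue integral. -/
def iteratedLIntegral (f : ι → ℝ → ℝ≥0∞) (a b : ℝ) (w : List ι) : ℝ≥0∞ :=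
  ∫⁻ t in simplex a b w.length, ∏ i, f (w.get i) (t i)

theorem iteratedLIntegral_nil (f : ι → ℝ → ℝ≥0∞) (a b : ℝ) : iteratedLIntegral f a b [] = 1 := by
  change ∫⁻ t in simplex a b 0, ∏ i : Fin 0, f (([] : List ι).get i) (t i) = 1
  rw [simplex_zero, Measure.restrict_univ, volume_pi, Measure.pi_of_empty, lintegral_dirac]
  exact Finset.prod_empty

theorem antitone_iteratedLIntegral (f : ι → ℝ → ℝ≥0∞) (b : ℝ) (w : List ι) :
    Antitone fun a => iteratedLIntegral f a b w :=
  fun _ _ h => lintegral_mono_set (simplex_subset_simplex h _)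

theorem iteratedLIntegral_cons (hf : ∀ i, Measurable (f i)) (a b : ℝ) (i : ι) (w : List ι) :
    iteratedLIntegral f a b (i :: w) =
      ∫⁻ x in Ioo a b, f i x * iteratedLIntegral f x b w := by
  have hprod (w : List ι) : Measurable fun t : Fin w.length → ℝ => ∏ j, f (w.get j) (t j) :=
    Finset.measurable_fun_prod _ fun j _ => (hf _).comp (measurable_pi_apply j)
  have hm := measurableSet_simplex a b (w.length + 1)
  have huncurry := lintegral_fin_succ ((hprod (i :: w)).indicator hm)
  rw [lintegral_indicator hm] at huncurry
  refine huncurry.trans ?_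
  rw [← lintegral_indicator measurableSet_Ioo]
  refine lintegral_congr fun x => ?_
  by_cases hx : x ∈ Ioo a b
  · rw [indicator_of_mem hx, iteratedLIntegral, ← lintegral_const_mul _ (hprod w),
      ← lintegral_indicator (measurableSet_simplex x b _)]
    refine lintegral_congr fun t => indicator_eq_indicator ?_ ?_
    · simp only [cons_mem_simplex, hx, true_and]
    · exact Fin.prod_univ_succ _
  · rw [indicator_of_notMem hx]
    refine lintegral_eq_zero_of_ae_eq_zero (.of_forall fun t => indicator_of_notMem ?_ _)
    exact fun h => hx (cons_mem_simplex.1 h).1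

theorem iteratedLIntegral_replicate (hf : ∀ i, Measurable (f i)) {i : ι} {g F : ℝ → ℝ} {a b : ℝ}
    (hab : a ≤ b) (hF : ContinuousOn F (Icc a b)) (hd : ∀ x ∈ Ioo a b, HasDerivAt F (g x) x)
    (hg : ∀ x ∈ Ioo a b, 0 ≤ g x) (hfg : ∀ x ∈ Ioo a b, f i x = ENNReal.ofReal (g x)) (n : ℕ) :
    iteratedLIntegral f a b (List.replicate n i) =
      ENNReal.ofReal ((F b - F a) ^ n / n.factorial) := by
  induction n generalizing a with
  | zero => simp [iteratedLIntegral_nil]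
  | succ n ih =>
    rw [List.replicate_succ, iteratedLIntegral_cons hf,
      ← lintegral_ofReal_deriv_mul_pow_div_factorial hab hF hd hg]
    refine setLIntegral_congr_fun measurableSet_Ioo fun x hx => ?_
    have hsub : Ioo x b ⊆ Ioo a b := Ioo_subset_Ioo_left hx.1.le
    rw [hfg x hx, ih hx.2.le (hF.mono (Icc_subset_Icc_left hx.1.le)) (fun y hy => hd y (hsub hy))
      (fun y hy => hg y (hsub hy)) (fun y hy => hfg y (hsub hy))]

theorem iteratedLIntegral_replicate_append (hf : ∀ i, Measurable (f i)) {i : ι} {g F : ℝ → ℝ}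
    (hFm : Measurable F) {a b : ℝ} (hF : ContinuousOn F (Ico a b))
    (hd : ∀ x ∈ Ioo a b, HasDerivAt F (g x) x) (hg : ∀ x ∈ Ioo a b, 0 ≤ g x)
    (hfg : ∀ x ∈ Ioo a b, f i x = ENNReal.ofReal (g x)) (n : ℕ) (j : ι) (w : List ι) :
    iteratedLIntegral f a b (List.replicate n i ++ j :: w) =
      ∫⁻ t in Ioo a b, f j t * iteratedLIntegral f t b w *
        ENNReal.ofReal ((F t - F a) ^ n / n.factorial) := by
  have hw : Measurable fun t => iteratedLIntegral f t b w :=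
    (antitone_iteratedLIntegral f b w).measurable
  induction n generalizing a with
  | zero => simp [iteratedLIntegral_cons hf]
  | succ n ih =>
    have hK : Measurable (Function.uncurry fun s t => f i s * (f j t *
        iteratedLIntegral f t b w * ENNReal.ofReal ((F t - F s) ^ n / n.factorial))) := by
      have := hf i
      have := hf j
      fun_prop
    have hinner (s : ℝ) (hs : s ∈ Ioo a b) :
        f i s * iteratedLIntegral f s b (List.replicate n i ++ j :: w) =
          ∫⁻ t in Ioo s b, f i s * (f j t * iteratedLIntegral f t b w *
            ENNReal.ofReal ((F t - F s) ^ n / n.factorial)) := by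
      have hsub : Ioo s b ⊆ Ioo a b := Ioo_subset_Ioo_left hs.1.le
      rw [ih (hF.mono (Ico_subset_Ico_left hs.1.le)) (fun x hx => hd x (hsub hx))
        (fun x hx => hg x (hsub hx)) (fun x hx => hfg x (hsub hx)),
        lintegral_const_mul _ (by have := hf j; fun_prop)]
    rw [List.replicate_succ, List.cons_append, iteratedLIntegral_cons hf,
      setLIntegral_congr_fun measurableSet_Ioo hinner, lintegral_Ioo_lintegral_Ioo_swap hK]
    refine setLIntegral_congr_fun measurableSet_Ioo fun t ht => ?_
    have hsub : Ioo a t ⊆ Ioo a b := Ioo_subset_Ioo_right ht.2.le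
    calc
      _ = ∫⁻ s in Ioo a t, f j t * iteratedLIntegral f t b w *
            (f i s * ENNReal.ofReal ((F t - F s) ^ n / n.factorial)) :=
        lintegral_congr fun s => mul_left_comm _ _ _
      _ = f j t * iteratedLIntegral f t b w *
            ∫⁻ s in Ioo a t, f i s * ENNReal.ofReal ((F t - F s) ^ n / n.factorial) :=
        lintegral_const_mul _ (by have := hf i; fun_prop)
      _ = _ := by
        rw [setLIntegral_congr_fun measurableSet_Ioo fun s hs => by rw [hfg s (hsub hs)],
          lintegral_ofReal_deriv_mul_pow_div_factorial ht.1.le (hF.mono (Icc_subset_Ico_right ht.2))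
            (fun x hx => hd x (hsub hx)) (fun x hx => hg x (hsub hx))]

end IteratedIntegrals

section DeformedForms

variable {c : ℝ}

theorem one_sub_mul_pos {t : ℝ} (hc : c < 1) (h0 : 0 ≤ t) (h1 : t < 1) : 0 < 1 - c * t := by
  nlinarith

theorem measurable_omega (c : ℝ) (e : Fin 2) : Measurable (omega c e) := by
  unfold omega
  split_ifs <;> fun_prop

theorem omega_nonneg (hc : c < 1) (e : Fin 2) {t : ℝ} (ht : t ∈ Ioo (0 : ℝ) 1) :
    0 ≤ omega c e t := by
  have := one_sub_mul_pos hc ht.1.le ht.2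
  have := ht.1
  have := sub_pos.2 ht.2
  have := sub_pos.2 hc
  unfold omega
  split_ifs <;> positivity

theorem measurable_integrand (c : ℝ) (w : List (Fin 2)) : Measurable (integrand c w) :=
  Finset.measurable_fun_prod _ fun i _ => (measurable_omega c _).comp (measurable_pi_apply i)

theorem measurableSet_openSimplex (k : ℕ) : MeasurableSet (openSimplex k) :=
  measurableSet_simplex 0 1 k

theorem integrand_nonneg (hc : c < 1) {w : List (Fin 2)} {t : Fin w.length → ℝ}
    (ht : t ∈ openSimplex w.length) : 0 ≤ integrand c w t :=
  Finset.prod_nonneg fun i _ => omega_nonneg hc _ (ht.1 i)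

theorem lintegral_ofReal_integrand (hc : c < 1) (w : List (Fin 2)) :
    ∫⁻ t in openSimplex w.length, ENNReal.ofReal (integrand c w t) =
      iteratedLIntegral (fun e t => ENNReal.ofReal (omega c e t)) 0 1 w :=
  setLIntegral_congr_fun (measurableSet_openSimplex _) fun _ ht =>
    ENNReal.ofReal_prod_of_nonneg fun i _ => omega_nonneg hc _ (ht.1 i)

/-- The primitive `L(t) = log ((1 - c t) / (1 - t))` of `ω₁` that vanishes at `0`. -/
def primitive (c t : ℝ) : ℝ :=
  Real.log (1 - c * t) - Real.log (1 - t)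

theorem primitive_zero (c : ℝ) : primitive c 0 = 0 := by simp [primitive]

theorem measurable_primitive (c : ℝ) : Measurable (primitive c) := by
  unfold primitive
  fun_prop

theorem hasDerivAt_primitive (hc : c < 1) {t : ℝ} (ht : t ∈ Ico (0 : ℝ) 1) :
    HasDerivAt (primitive c) (omega c 1 t) t := by
  have h1 := (one_sub_mul_pos hc ht.1 ht.2).ne'
  have h2 := (sub_pos.2 ht.2).ne'
  convert! ((((hasDerivAt_id t).const_mul c).const_sub 1).log h1).sub
    (((hasDerivAt_id t).const_sub 1).log h2) using 1
  simp only [omega, id, one_ne_zero, if_false]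
  field_simp
  ring

theorem primitive_nonneg (hc : c < 1) {t : ℝ} (ht : t ∈ Ioo (0 : ℝ) 1) : 0 ≤ primitive c t :=
  sub_nonneg.2 (Real.log_le_log (sub_pos.2 ht.2) (by nlinarith [ht.1]))

/-- The integrand of the one-dimensional integral that computes `Z_c(1, …, 1, m + 1)` with `n`
ones: after integrating out the letters before and after the last `ω₁`, only its variable `t` is
left. -/
def kernel (c : ℝ) (m n : ℕ) (t : ℝ) : ℝ :=
  omega c 1 t * ((-Real.log t) ^ m / m.factorial) * (primitive c t ^ n / n.factorial)

theorem measurable_kernel (c : ℝ) (m n : ℕ) : Measurable (kernel c m n) := by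
  have := measurable_primitive c
  have := measurable_omega c 1
  unfold kernel
  fun_prop

theorem kernel_nonneg (hc : c < 1) (m n : ℕ) {t : ℝ} (ht : t ∈ Ioo (0 : ℝ) 1) :
    0 ≤ kernel c m n t := by
  have := omega_nonneg hc 1 ht
  have := neg_nonneg.2 (Real.log_nonpos ht.1.le ht.2.le)
  have := primitive_nonneg hc ht
  unfold kernel
  positivity

theorem wordOf_replicate_one_append (m n : ℕ) :
    wordOf (List.replicate n 1 ++ [m + 1]) = List.replicate n 1 ++ 1 :: List.replicate m 0 := by
  simp [wordOf, List.flatMap_append, List.flatMap_replicate]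

theorem iteratedLIntegral_omega_replicate_zero (c : ℝ) (m : ℕ) {t : ℝ} (ht : t ∈ Ioo (0 : ℝ) 1) :
    iteratedLIntegral (fun e t => ENNReal.ofReal (omega c e t)) t 1 (List.replicate m 0) =
      ENNReal.ofReal ((-Real.log t) ^ m / m.factorial) := by
  have hne {x : ℝ} (hx : t ≤ x) : x ≠ 0 := (ht.1.trans_le hx).ne'
  rw [iteratedLIntegral_replicate (fun e => (measurable_omega c e).ennreal_ofReal) ht.2.le
    (Real.continuousOn_log.mono fun x hx => hne hx.1)
    (fun x hx => Real.hasDerivAt_log (hne hx.1.le))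
    (fun x hx => inv_nonneg.2 (ht.1.trans hx.1).le) (fun _ _ => by simp [omega]),
    Real.log_one, zero_sub]

theorem lintegral_ofReal_integrand_replicate_one_append (hc : c < 1) (m n : ℕ) :
    ∫⁻ t in openSimplex (wordOf (List.replicate n 1 ++ [m + 1])).length,
        ENNReal.ofReal (integrand c (wordOf (List.replicate n 1 ++ [m + 1])) t) =
      ∫⁻ t in Ioo (0 : ℝ) 1, ENNReal.ofReal (kernel c m n t) := by
  rw [lintegral_ofReal_integrand hc, wordOf_replicate_one_append,
    iteratedLIntegral_replicate_append (fun e => (measurable_omega c e).ennreal_ofReal)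
      (measurable_primitive c)
      (fun x hx => (hasDerivAt_primitive hc hx).continuousAt.continuousWithinAt)
      (fun x hx => hasDerivAt_primitive hc (Ioo_subset_Ico_self hx))
      (fun x hx => omega_nonneg hc 1 hx) (fun _ _ => rfl)]
  refine setLIntegral_congr_fun measurableSet_Ioo fun t ht => ?_
  have hω := omega_nonneg hc 1 ht
  have hlog := neg_nonneg.2 (Real.log_nonpos ht.1.le ht.2.le)
  simp only [iteratedLIntegral_omega_replicate_zero c m ht, primitive_zero, sub_zero]
  rw [kernel, ENNReal.ofReal_mul (by positivity), ENNReal.ofReal_mul hω]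

theorem integrableOn_integrand (hc : c < 1) {m n : ℕ}
    (h : IntegrableOn (kernel c m n) (Ioo 0 1)) :
    IntegrableOn (integrand c (wordOf (List.replicate n 1 ++ [m + 1])))
      (openSimplex (wordOf (List.replicate n 1 ++ [m + 1])).length) := by
  refine ⟨(measurable_integrand c _).aestronglyMeasurable, ?_⟩
  rw [hasFiniteIntegral_iff_ofReal (ae_restrict_of_forall_mem (measurableSet_openSimplex _)
    fun t ht => integrand_nonneg hc ht), lintegral_ofReal_integrand_replicate_one_append hc]
  exact (hasFiniteIntegral_iff_ofReal (ae_restrict_of_forall_mem measurableSet_Ioo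
    fun t ht => kernel_nonneg hc m n ht)).1 h.2

theorem Z_eq_integral_kernel (hc : c < 1) (m n : ℕ) :
    Z c (List.replicate n 1 ++ [m + 1]) = ∫ t in Ioo (0 : ℝ) 1, kernel c m n t := by
  rw [Z, iteratedI,
    integral_eq_lintegral_of_nonneg_ae (ae_restrict_of_forall_mem (measurableSet_openSimplex _)
      fun t ht => integrand_nonneg hc ht) (measurable_integrand c _).aestronglyMeasurable,
    integral_eq_lintegral_of_nonneg_ae (ae_restrict_of_forall_mem measurableSet_Ioo
      fun t ht => kernel_nonneg hc m n ht) (measurable_kernel c m n).aestronglyMeasurable,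
    lintegral_ofReal_integrand_replicate_one_append hc]

end DeformedForms

section RegularizedBeta

theorem one_sub_ofReal_ne_zero {t : ℝ} (ht : t < 1) : (1 - t : ℂ) ≠ 0 :=
  mod_cast (sub_pos.2 ht).ne'

theorem hasDerivAt_ofReal_cpow {x : ℝ} (hx : 0 < x) (u : ℂ) :
    HasDerivAt (fun t : ℝ => (t : ℂ) ^ u) (u * (x : ℂ) ^ (u - 1)) x := by
  simpa using ((hasDerivAt_id (x : ℂ)).cpow_const (c := u)
    (Complex.ofReal_mem_slitPlane.2 hx)).comp_ofReal

theorem hasDerivAt_one_sub_ofReal_cpow {x : ℝ} (hx : x < 1) (u : ℂ) :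
    HasDerivAt (fun t : ℝ => (1 - t : ℂ) ^ u) (-(u * (1 - x : ℂ) ^ (u - 1))) x := by
  simpa [Function.comp_def] using
    (hasDerivAt_ofReal_cpow (sub_pos.2 hx) u).scomp x ((hasDerivAt_id x).const_sub 1)

theorem intervalIntegrable_one_sub_cpow {s : ℂ} (hs : -1 < s.re) (a b : ℝ) :
    IntervalIntegrable (fun t : ℝ => (1 - t : ℂ) ^ s) volume a b := by
  simpa using
    (intervalIntegral.intervalIntegrable_cpow' (a := 1 - a) (b := 1 - b) hs).comp_sub_left 1

section

variable {g : ℝ → ℂ} {s : ℂ}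

theorem one_sub_cpow_mul_eq_dslope (h1 : g 1 = 0) (s : ℂ) {t : ℝ} (ht : t < 1) :
    (1 - t : ℂ) ^ s * g t = -((1 - t : ℂ) ^ (s + 1) * dslope g 1 t) := by
  have hg : g t = (t - 1 : ℂ) * dslope g 1 t := by
    have h := sub_smul_dslope g 1 t
    rw [h1, sub_zero, Complex.real_smul] at h
    exact_mod_cast h.symm
  rw [hg, Complex.cpow_add _ _ (one_sub_ofReal_ne_zero ht), Complex.cpow_one]
  ring

theorem tendsto_one_sub_cpow_mul (hd : DifferentiableAt ℝ g 1) (h1 : g 1 = 0)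
    (hs : -1 < s.re) :
    Tendsto (fun t : ℝ => (1 - t : ℂ) ^ s * g t) (𝓝[<] 1) (𝓝 0) := by
  have hs' : 0 < (s + 1).re := by
    rw [Complex.add_re, Complex.one_re]
    linarith
  have hcpow : ContinuousAt (fun t : ℝ => (1 - t : ℂ) ^ (s + 1)) 1 := by
    have h0 : ContinuousAt (fun t : ℝ => (t : ℂ) ^ (s + 1)) (1 - 1) :=
      Complex.continuousAt_ofReal_cpow_const _ _ (.inl hs')
    simpa [Function.comp_def] using
      ContinuousAt.comp (f := fun t : ℝ => 1 - t) h0 (by fun_prop)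
  have hne : s + 1 ≠ 0 := fun h => by simp [h] at hs'
  have hlim : Tendsto (fun t : ℝ => -((1 - t : ℂ) ^ (s + 1) * dslope g 1 t)) (𝓝 1) (𝓝 0) := by
    simpa [hne] using (hcpow.tendsto.mul (continuousAt_dslope_same.2 hd).tendsto).neg
  refine (hlim.mono_left nhdsWithin_le_nhds).congr' ?_
  filter_upwards [self_mem_nhdsWithin] with t ht
  exact (one_sub_cpow_mul_eq_dslope h1 s ht).symm

theorem intervalIntegrable_one_sub_cpow_mul (hg : IntervalIntegrable g volume 0 1)
    (hc : ContinuousOn g (Ioi 0)) (hd : DifferentiableAt ℝ g 1) (h1 : g 1 = 0)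
    (hs : -2 < s.re) :
    IntervalIntegrable (fun t : ℝ => (1 - t : ℂ) ^ s * g t) volume 0 1 := by
  refine .trans (b := 1 / 2) ?_ ?_
  · refine (hg.mono_set (uIcc_subset_uIcc_left ?_)).continuousOn_mul fun t ht => ?_
    · norm_num [mem_uIcc]
    · rw [uIcc_of_le (by norm_num)] at ht
      exact (hasDerivAt_one_sub_ofReal_cpow (by linarith [ht.2]) s).continuousAt.continuousWithinAt
  · have hcpow := intervalIntegrable_one_sub_cpow (s := s + 1)
      (by rw [Complex.add_re, Complex.one_re]; linarith) (1 / 2) 1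
    have hdslope : ContinuousOn (dslope g 1) (uIcc (1 / 2) 1) := by
      refine ((continuousOn_dslope (Ioi_mem_nhds one_pos)).2 ⟨hc, hd⟩).mono fun t ht => ?_
      rw [uIcc_of_le (by norm_num)] at ht
      exact half_pos one_pos |>.trans_le ht.1
    refine (hcpow.mul_continuousOn hdslope).neg.congr_uIoo fun t ht => ?_
    rw [uIoo_of_le (by norm_num)] at ht
    exact (one_sub_cpow_mul_eq_dslope h1 s ht.2).symm

end

variable {a b s : ℂ}

theorem intervalIntegrable_one_sub_cpow_mul_cpow_sub_cpow (ha : 0 < a.re) (hb : 0 < b.re)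
    (hs : -1 < s.re) :
    IntervalIntegrable
      (fun t : ℝ => (1 - t : ℂ) ^ (s - 1) * ((t : ℂ) ^ (a - 1) - (t : ℂ) ^ (b - 1)))
      volume 0 1 := by
  have hcpow (u : ℂ) (hu : 0 < u.re) :
      IntervalIntegrable (fun t : ℝ => (t : ℂ) ^ (u - 1)) volume 0 1 :=
    intervalIntegral.intervalIntegrable_cpow' (by rw [Complex.sub_re, Complex.one_re]; linarith)
  have hderiv {t : ℝ} (ht : 0 < t) :=
    (hasDerivAt_ofReal_cpow ht (a - 1)).sub (hasDerivAt_ofReal_cpow ht (b - 1))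
  refine intervalIntegrable_one_sub_cpow_mul ((hcpow a ha).sub (hcpow b hb))
    (fun t ht => (hderiv ht).continuousAt.continuousWithinAt)
    (hderiv one_pos).differentiableAt (by simp) ?_
  rw [Complex.sub_re, Complex.one_re]
  linarith

theorem hasDerivAt_one_sub_cpow_mul_cpow_sub_cpow (a b s : ℂ) {x : ℝ} (hx : x ∈ Ioo (0 : ℝ) 1) :
    HasDerivAt (fun t : ℝ => (1 - t : ℂ) ^ s * ((t : ℂ) ^ a - (t : ℂ) ^ b))
      ((a + s) * ((x : ℂ) ^ (a - 1) * (1 - x : ℂ) ^ s) -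
        (b + s) * ((x : ℂ) ^ (b - 1) * (1 - x : ℂ) ^ s) -
        s * ((1 - x : ℂ) ^ (s - 1) * ((x : ℂ) ^ (a - 1) - (x : ℂ) ^ (b - 1)))) x := by
  have hx0 : (x : ℂ) ≠ 0 := Complex.ofReal_ne_zero.2 hx.1.ne'
  have hx1 : (1 - x : ℂ) ≠ 0 := one_sub_ofReal_ne_zero hx.2
  convert! (hasDerivAt_one_sub_ofReal_cpow hx.2 s).mul
    ((hasDerivAt_ofReal_cpow hx.1 a).sub (hasDerivAt_ofReal_cpow hx.1 b)) using 1
  simp only [Pi.sub_apply, Complex.cpow_sub _ _ hx0, Complex.cpow_sub _ _ hx1, Complex.cpow_one]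
  field_simp
  ring

theorem tendsto_one_sub_cpow_mul_cpow_sub_cpow_zero (ha : 0 < a.re) (hb : 0 < b.re) (s : ℂ) :
    Tendsto (fun t : ℝ => (1 - t : ℂ) ^ s * ((t : ℂ) ^ a - (t : ℂ) ^ b)) (𝓝[>] 0) (𝓝 0) := by
  have hcpow (u : ℂ) (hu : 0 < u.re) : Tendsto (fun t : ℝ => (t : ℂ) ^ u) (𝓝 0) (𝓝 0) := by
    have hne : u ≠ 0 := fun h => by simp [h] at hu
    simpa [hne] using (Complex.continuousAt_ofReal_cpow_const 0 u (.inl hu)).tendsto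
  have hlim := (hasDerivAt_one_sub_ofReal_cpow one_pos s).continuousAt.tendsto.mul
    ((hcpow a ha).sub (hcpow b hb))
  rw [sub_zero, mul_zero] at hlim
  exact hlim.mono_left nhdsWithin_le_nhds

theorem add_mul_betaIntegral_add_one (ha : 0 < a.re) (hs : -1 < s.re) :
    (a + s) * Complex.betaIntegral a (s + 1) =
      Complex.Gamma (s + 1) * (Complex.Gamma a / Complex.Gamma (a + s)) := by
  rw [Complex.betaIntegral_eq_Gamma_mul_div _ _ ha
    (by rw [Complex.add_re, Complex.one_re]; linarith), div_eq_mul_inv, div_eq_mul_inv,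
    Complex.one_div_Gamma_eq_self_mul_one_div_Gamma_add_one (a + s), add_assoc]
  ring

theorem mul_integral_one_sub_cpow_mul_cpow_sub_cpow (ha : 0 < a.re) (hb : 0 < b.re)
    (hs : -1 < s.re) :
    s * ∫ t in (0 : ℝ)..1, (1 - t : ℂ) ^ (s - 1) * ((t : ℂ) ^ (a - 1) - (t : ℂ) ^ (b - 1)) =
      Complex.Gamma (s + 1) * (Complex.Gamma a / Complex.Gamma (a + s) -
        Complex.Gamma b / Complex.Gamma (b + s)) := by
  have hs' : 0 < (s + 1).re := by
    rw [Complex.add_re, Complex.one_re]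
    linarith
  have hA := (Complex.betaIntegral_convergent ha hs').const_mul (a + s)
  have hB := (Complex.betaIntegral_convergent hb hs').const_mul (b + s)
  have hJ := (intervalIntegrable_one_sub_cpow_mul_cpow_sub_cpow ha hb hs).const_mul s
  have hdiff : DifferentiableAt ℝ (fun t : ℝ => (t : ℂ) ^ a - (t : ℂ) ^ b) 1 :=
    ((hasDerivAt_ofReal_cpow one_pos a).sub (hasDerivAt_ofReal_cpow one_pos b)).differentiableAt
  simp only [add_sub_cancel_right] at hA hB
  have hparts := intervalIntegral.integral_eq_sub_of_hasDerivAt_of_tendsto zero_lt_one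
    (fun x hx => hasDerivAt_one_sub_cpow_mul_cpow_sub_cpow a b s hx) ((hA.sub hB).sub hJ)
    (tendsto_one_sub_cpow_mul_cpow_sub_cpow_zero ha hb s)
    (tendsto_one_sub_cpow_mul hdiff (by simp) hs)
  rw [intervalIntegral.integral_sub (hA.sub hB) hJ, intervalIntegral.integral_sub hA hB] at hparts
  simp only [intervalIntegral.integral_const_mul] at hparts
  rw [mul_sub, ← add_mul_betaIntegral_add_one ha hs, ← add_mul_betaIntegral_add_one hb hs]
  simp only [Complex.betaIntegral, add_sub_cancel_right]
  linear_combination -hparts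

end RegularizedBeta

section EulerTransform

theorem one_sub_mul_mem_slitPlane {z : ℂ} (hz : z ∈ cutPlane) {t : ℝ} (ht : t ∈ Icc (0 : ℝ) 1) :
    1 - z * t ∈ Complex.slitPlane := by
  rw [Complex.mem_slitPlane_iff]
  rcases ht.1.eq_or_lt with h0 | h0
  · simp [← h0]
  rcases hz with hre | him
  · left
    simp only [Complex.sub_re, Complex.one_re, Complex.re_mul_ofReal]
    nlinarith [ht.2]
  · right
    simpa using ⟨him, h0.ne'⟩

theorem one_sub_ne_zero_of_mem_cutPlane {z : ℂ} (hz : z ∈ cutPlane) : 1 - z ≠ 0 := by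
  simpa using Complex.slitPlane_ne_zero (one_sub_mul_mem_slitPlane hz (right_mem_Icc.2 zero_le_one))

theorem ofReal_mem_cutPlane {c : ℝ} (hc : c < 1) : (c : ℂ) ∈ cutPlane :=
  .inl hc

theorem exists_norm_one_sub_mul_cpow_le {K : Set ℂ} (hK : IsCompact K) (hKc : K ⊆ cutPlane)
    (u : ℂ) : ∃ C, ∀ z ∈ K, ∀ t ∈ Icc (0 : ℝ) 1, ‖(1 - z * t : ℂ) ^ u‖ ≤ C := by
  have hcont : ContinuousOn (fun p : ℂ × ℝ => (1 - p.1 * p.2 : ℂ) ^ u) (K ×ˢ Icc 0 1) :=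
    .cpow_const (by fun_prop) fun _ hp => one_sub_mul_mem_slitPlane (hKc hp.1) hp.2
  obtain ⟨C, hC⟩ := (hK.prod isCompact_Icc).exists_bound_of_continuousOn hcont
  exact ⟨C, fun z hz t ht => hC (z, t) ⟨hz, ht⟩⟩

theorem hasDerivAt_one_sub_mul_cpow {z : ℂ} (hz : z ∈ cutPlane) {t : ℝ} (ht : t ∈ Icc (0 : ℝ) 1)
    (u : ℂ) :
    HasDerivAt (fun z : ℂ => (1 - z * t) ^ u) (-(u * t * (1 - z * t) ^ (u - 1))) z := by
  convert! (((hasDerivAt_id z).mul_const (t : ℂ)).const_sub 1).cpow_const (c := u)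
    (one_sub_mul_mem_slitPlane hz ht) using 1
  simp only [id]
  ring

/-- The Euler transform `∫₀¹ φ(t) (1 - z t) ^ (-b) dt` of a weight `φ` on `(0, 1)`, as a function
of `z` in the cut plane. For `φ(t) = t ^ (a - 1) (1 - t) ^ (d - a - 1)` it is Euler's integral for
`₂F₁(a, b; d; z)`. -/
def eulerTransform (φ : ℝ → ℂ) (b z : ℂ) : ℂ :=
  ∫ t in Ioo (0 : ℝ) 1, φ t * (1 - z * t) ^ (-b)

variable {φ : ℝ → ℂ}

theorem integrableOn_mul_one_sub_mul_cpow (hφ : IntegrableOn φ (Ioo 0 1)) {z : ℂ}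
    (hz : z ∈ cutPlane) (u : ℂ) :
    IntegrableOn (fun t : ℝ => φ t * (1 - z * t) ^ u) (Ioo 0 1) := by
  obtain ⟨C, hC⟩ :=
    exists_norm_one_sub_mul_cpow_le isCompact_singleton (singleton_subset_iff.2 hz) u
  refine hφ.mul_bdd (c := C)
    (by fun_prop : Measurable fun t : ℝ => (1 - z * t) ^ u).aestronglyMeasurable
    (ae_restrict_of_forall_mem measurableSet_Ioo fun t ht => ?_)
  exact hC z rfl t (Ioo_subset_Icc_self ht)

theorem differentiableOn_eulerTransform (hφ : IntegrableOn φ (Ioo 0 1)) (b : ℂ) :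
    DifferentiableOn ℂ (eulerTransform φ b) cutPlane := by
  intro z₀ hz₀
  obtain ⟨r, hr, hball⟩ := Metric.nhds_basis_closedBall.mem_iff.1 (isOpen_cutPlane.mem_nhds hz₀)
  obtain ⟨C, hC⟩ := exists_norm_one_sub_mul_cpow_le (isCompact_closedBall z₀ r) hball (-b - 1)
  have hbound : ∀ t ∈ Ioo (0 : ℝ) 1, ∀ z ∈ Metric.closedBall z₀ r,
      ‖φ t * -(-b * t * (1 - z * t) ^ (-b - 1))‖ ≤ ‖φ t‖ * (‖b‖ * C) := by
    intro t ht z hz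
    rw [norm_mul, norm_neg, norm_mul, norm_mul, norm_neg, Complex.norm_of_nonneg ht.1.le]
    gcongr
    · exact mul_le_of_le_one_right (norm_nonneg b) ht.2.le
    · exact hC z hz t (Ioo_subset_Icc_self ht)
  have hmeas (z : ℂ) (u : ℂ) : Measurable fun t : ℝ => (1 - z * t) ^ u := by fun_prop
  refine (hasDerivAt_integral_of_dominated_loc_of_deriv_le (𝕜 := ℂ)
    (F' := fun z t => φ t * -(-b * t * (1 - z * t) ^ (-b - 1)))
    (Metric.closedBall_mem_nhds z₀ hr)
    (.of_forall fun z => hφ.1.mul (hmeas z (-b)).aestronglyMeasurable)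
    (integrableOn_mul_one_sub_mul_cpow hφ hz₀ (-b))
    (hφ.1.mul (by fun_prop : Measurable _).aestronglyMeasurable)
    (ae_restrict_of_forall_mem measurableSet_Ioo hbound) (hφ.norm.mul_const (‖b‖ * C))
    (ae_restrict_of_forall_mem measurableSet_Ioo fun t ht z hz => ?_)
    ).2.differentiableAt.differentiableWithinAt
  exact (hasDerivAt_one_sub_mul_cpow (hball hz) (Ioo_subset_Icc_self ht) (-b)).const_mul (φ t)

theorem choose_add_sub_one_eq_ascPochhammer_eval (b : ℂ) (n : ℕ) :
    Ring.choose (b + n - 1) n = (ascPochhammer ℂ n).eval b / n.factorial := by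
  have hmultichoose := Ring.factorial_nsmul_multichoose_eq_ascPochhammer b n
  rw [Polynomial.ascPochhammer_smeval_eq_eval, nsmul_eq_mul] at hmultichoose
  rw [eq_div_iff (Nat.cast_ne_zero.2 n.factorial_ne_zero), ← hmultichoose, mul_comm, Ring.choose,
    show b + n - 1 - n + 1 = b by ring]

theorem hasSum_one_sub_cpow_neg (b : ℂ) {w : ℂ} (hw : ‖w‖ < 1) :
    HasSum (fun n : ℕ => (ascPochhammer ℂ n).eval b / n.factorial * w ^ n) ((1 - w) ^ (-b)) := by
  have hseries := (Complex.one_div_one_sub_cpow_hasFPowerSeriesOnBall_zero b).hasSum (y := w)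
    (by simpa [enorm_eq_nnnorm, ← NNReal.coe_lt_one] using hw)
  simpa [FormalMultilinearSeries.ofScalars_apply_eq, choose_add_sub_one_eq_ascPochhammer_eval,
    Complex.cpow_neg, mul_comm] using hseries

theorem hasSum_eulerTransform (hφ : IntegrableOn φ (Ioo 0 1)) (b : ℂ) {z : ℂ} (hz : ‖z‖ < 1) :
    HasSum (fun n : ℕ => (ascPochhammer ℂ n).eval b / n.factorial *
      (∫ t in Ioo (0 : ℝ) 1, φ t * (t : ℂ) ^ n) * z ^ n) (eulerTransform φ b z) := by
  let coeff (n : ℕ) : ℂ := (ascPochhammer ℂ n).eval b / n.factorial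
  have hnorm {t : ℝ} (ht : t ∈ Ioo (0 : ℝ) 1) : ‖z * t‖ ≤ ‖z‖ := by
    rw [norm_mul, Complex.norm_of_nonneg ht.1.le]
    exact mul_le_of_le_one_right (norm_nonneg z) ht.2.le
  have hsummable : Summable fun n => ‖coeff n * z ^ n‖ :=
    (hasSum_one_sub_cpow_neg b hz).summable.norm
  have hsum := hasSum_integral_of_dominated_convergence
    (μ := volume.restrict (Ioo (0 : ℝ) 1)) (F := fun n t => φ t * (coeff n * (z * t) ^ n))
    (fun n t => ‖φ t‖ * ‖coeff n * z ^ n‖)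
    (fun n => hφ.1.mul (by fun_prop : Measurable _).aestronglyMeasurable)
    (fun n => ae_restrict_of_forall_mem measurableSet_Ioo fun t ht => ?_)
    (.of_forall fun t => hsummable.mul_left _)
    (by simpa only [tsum_mul_left] using hφ.norm.mul_const _)
    (ae_restrict_of_forall_mem measurableSet_Ioo fun t ht =>
      (hasSum_one_sub_cpow_neg b ((hnorm ht).trans_lt hz)).mul_left (φ t))
  · refine hsum.congr_fun fun n => ?_
    rw [← integral_const_mul, ← integral_mul_const]
    refine integral_congr_ae (.of_forall fun t => ?_)
    simp only [coeff, mul_pow]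
    ring
  · rw [norm_mul, norm_mul (coeff n), norm_mul (coeff n), norm_pow, norm_pow]
    gcongr
    exact hnorm ht

end EulerTransform

section RegularizedEulerIntegral

/-- The weight of the regularised Euler integral: `(1 - t) ^ (b - 2) t ^ (a - 1)` need not be
integrable at `t = 1` for `0 < Re b`, and the subtracted `1` makes it so. -/
def eulerKernel (a b : ℂ) (t : ℝ) : ℂ :=
  (1 - t) ^ (b - 2) * ((t : ℂ) ^ (a - 1) - 1)

variable {a b : ℂ}

theorem neg_one_lt_sub_one_re (hb : 0 < b.re) : -1 < (b - 1).re := by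
  rw [Complex.sub_re, Complex.one_re]
  linarith

theorem integrableOn_eulerKernel (ha : 0 < a.re) (hb : 0 < b.re) :
    IntegrableOn (eulerKernel a b) (Ioo 0 1) := by
  have hint := intervalIntegrable_one_sub_cpow_mul_cpow_sub_cpow ha (b := 1) (by simp)
    (neg_one_lt_sub_one_re hb)
  rw [intervalIntegrable_iff_integrableOn_Ioo_of_le zero_le_one] at hint
  simp only [sub_self, Complex.cpow_zero, sub_sub, one_add_one_eq_two] at hint
  exact hint

theorem sub_one_mul_integral_eulerKernel_mul_pow (ha : 0 < a.re) (hb : 0 < b.re) (n : ℕ) :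
    (b - 1) * ∫ t in Ioo (0 : ℝ) 1, eulerKernel a b t * (t : ℂ) ^ n =
      Complex.Gamma b * (Complex.Gamma (a + n) / Complex.Gamma (a + b - 1 + n) -
        n.factorial / Complex.Gamma (b + n)) := by
  have hbeta := mul_integral_one_sub_cpow_mul_cpow_sub_cpow (a := a + n) (b := n + 1)
    (s := b - 1) (by simpa using by positivity) (by simpa using by positivity)
    (neg_one_lt_sub_one_re hb)
  rw [intervalIntegral.integral_of_le zero_le_one, integral_Ioc_eq_integral_Ioo,
    Complex.Gamma_nat_eq_factorial, sub_add_cancel, show a + n + (b - 1) = a + b - 1 + n by ring,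
    show n + 1 + (b - 1) = b + n by ring] at hbeta
  rw [← hbeta]
  congr 1
  refine setIntegral_congr_fun measurableSet_Ioo fun t ht => ?_
  have ht0 : (t : ℂ) ≠ 0 := Complex.ofReal_ne_zero.2 ht.1.ne'
  simp only [eulerKernel]
  rw [add_sub_right_comm, Complex.cpow_add _ _ ht0, add_sub_cancel_right, Complex.cpow_natCast,
    sub_sub, one_add_one_eq_two]
  ring

/-- The regularised Euler integral `∫₀¹ (1 - t) ^ (b - 2) (t ^ (a - 1) - 1) (1 - z t) ^ (-b) dt`. -/
def eulerIntegral (a b z : ℂ) : ℂ :=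
  eulerTransform (eulerKernel a b) b z

theorem Gamma_mul_ascPochhammer_eval (ha : 0 < a.re) (n : ℕ) :
    Complex.Gamma a * (ascPochhammer ℂ n).eval a = Complex.Gamma (a + n) := by
  have hpole : ∀ k : ℕ, a ≠ -k := by
    rintro k rfl
    simp at ha
    linarith [k.cast_nonneg (α := ℝ)]
  rw [← Complex.Gamma_add_nat_div_Gamma_eq a hpole,
    mul_div_cancel₀ _ (Complex.Gamma_ne_zero_of_re_pos ha)]

theorem one_add_ascPochhammer_mul_integral_eulerKernel (ha : 0 < a.re) (hb : 0 < b.re) (n : ℕ) :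
    1 + (b - 1) * ((ascPochhammer ℂ n).eval b / n.factorial *
        ∫ t in Ioo (0 : ℝ) 1, eulerKernel a b t * (t : ℂ) ^ n) =
      Complex.Gamma a * Complex.Gamma b *
        (Complex.regularizedGaussHGFunSeries a b (a + b - 1)).coeff n := by
  have hfact : (n.factorial : ℂ) ≠ 0 := Nat.cast_ne_zero.2 n.factorial_ne_zero
  have hGamma : Complex.Gamma (b + n) ≠ 0 :=
    Complex.Gamma_ne_zero_of_re_pos (by simpa using by positivity)
  calc
    _ = 1 + (ascPochhammer ℂ n).eval b / n.factorial *
        ((b - 1) * ∫ t in Ioo (0 : ℝ) 1, eulerKernel a b t * (t : ℂ) ^ n) := by ring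
    _ = 1 + Complex.Gamma b * (ascPochhammer ℂ n).eval b / n.factorial *
        (Complex.Gamma (a + n) / Complex.Gamma (a + b - 1 + n) -
          n.factorial / Complex.Gamma (b + n)) := by
      rw [sub_one_mul_integral_eulerKernel_mul_pow ha hb]
      ring
    _ = Complex.Gamma (a + n) * Complex.Gamma (b + n) /
        (n.factorial * Complex.Gamma (a + b - 1 + n)) := by
      rw [Gamma_mul_ascPochhammer_eval hb]
      field_simp
      ring
    _ = _ := by
      rw [Complex.coeff_regularizedGaussHGFunSeries, ← Gamma_mul_ascPochhammer_eval ha,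
        ← Gamma_mul_ascPochhammer_eval hb]
      ring

theorem inv_one_sub_add_eulerIntegral_eq (ha : 0 < a.re) (hb : 0 < b.re) {z : ℂ} (hz : ‖z‖ < 1) :
    (1 - z)⁻¹ + (b - 1) * eulerIntegral a b z =
      Complex.Gamma a * Complex.Gamma b * Complex.regularizedGaussHGFun a b (a + b - 1) z := by
  have hsum := (hasSum_geometric_of_norm_lt_one hz).add
    ((hasSum_eulerTransform (integrableOn_eulerKernel ha hb) b hz).mul_left (b - 1))
  rw [eulerIntegral, ← hsum.tsum_eq, Complex.regularizedGaussHGFun, FormalMultilinearSeries.sum,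
    ← tsum_mul_left]
  refine tsum_congr fun n => ?_
  rw [FormalMultilinearSeries.apply_eq_pow_smul_coeff, smul_eq_mul, mul_left_comm (_ * _),
    ← one_add_ascPochhammer_mul_integral_eulerKernel ha hb]
  ring

theorem isGaussContinuation_inv_one_sub_add_eulerIntegral (ha : 0 < a.re) (hb : 0 < b.re)
    (hab : ∀ k : ℕ, a + b - 1 ≠ -k) :
    IsGaussContinuation a b (a + b - 1) fun z =>
      Complex.Gamma (a + b - 1) / (Complex.Gamma a * Complex.Gamma b) *
        ((1 - z)⁻¹ + (b - 1) * eulerIntegral a b z) := by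
  refine ⟨.const_mul (.add (.inv (by fun_prop) fun z hz => one_sub_ne_zero_of_mem_cutPlane hz)
    ((differentiableOn_eulerTransform (integrableOn_eulerKernel ha hb) b).const_mul (b - 1))) _,
    fun z hz => ?_⟩
  have hΓa := Complex.Gamma_ne_zero_of_re_pos ha
  have hΓb := Complex.Gamma_ne_zero_of_re_pos hb
  have hΓ := Complex.Gamma_ne_zero hab
  simp only [inv_one_sub_add_eulerIntegral_eq ha hb (mem_ball_zero_iff.1 hz),
    ← Complex.ordinaryHypergeometric_div_Gamma_eq hab]
  field_simp

theorem Gamma_mul_gaussHypergeometric (ha : 0 < a.re) (hb : 0 < b.re)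
    (hab : ∀ k : ℕ, a + b - 1 ≠ -k) {z : ℂ} (hz : z ∈ cutPlane) :
    Complex.Gamma a * Complex.Gamma b / Complex.Gamma (a + b - 1) *
        gaussHypergeometric a b (a + b - 1) z =
      (1 - z)⁻¹ + (b - 1) * eulerIntegral a b z := by
  have hΓa := Complex.Gamma_ne_zero_of_re_pos ha
  have hΓb := Complex.Gamma_ne_zero_of_re_pos hb
  have hΓ := Complex.Gamma_ne_zero hab
  rw [gaussHypergeometric_eq (isGaussContinuation_inv_one_sub_add_eulerIntegral ha hb hab) hz]
  field_simp

end RegularizedEulerIntegral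

section GeneratingFunction

variable {c : ℝ}

theorem hasSum_pow_div_factorial (x : ℂ) :
    HasSum (fun n : ℕ => x ^ n / n.factorial) (Complex.exp x) := by
  rw [Complex.exp_eq_exp_ℂ]
  exact NormedSpace.expSeries_div_hasSum_exp x

theorem hasSum_pow_succ_div_factorial (x : ℂ) :
    HasSum (fun n : ℕ => x ^ (n + 1) / (n + 1).factorial) (Complex.exp x - 1) := by
  simpa using (hasSum_nat_add_iff' 1).2 (hasSum_pow_div_factorial x)

theorem exp_primitive_mul (hc : c < 1) {t : ℝ} (ht : t ∈ Ioo (0 : ℝ) 1) (Y : ℂ) :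
    Complex.exp (primitive c t * Y) = (1 - c * t : ℂ) ^ Y * (1 - t : ℂ) ^ (-Y) := by
  have hct := one_sub_mul_pos hc ht.1.le ht.2
  have hct' : (1 - c * t : ℂ) ≠ 0 := mod_cast hct.ne'
  rw [Complex.cpow_def_of_ne_zero hct', Complex.cpow_def_of_ne_zero (one_sub_ofReal_ne_zero ht.2),
    ← Complex.exp_add, primitive, Complex.ofReal_sub, Complex.ofReal_log hct.le,
    Complex.ofReal_log (sub_pos.2 ht.2).le]
  push_cast
  ring_nf

theorem omega_mul_exp_primitive_mul (hc : c < 1) {t : ℝ} (ht : t ∈ Ioo (0 : ℝ) 1) (Y : ℂ) :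
    omega c 1 t * Complex.exp (primitive c t * Y) =
      (1 - c) * (1 - c * t : ℂ) ^ (Y - 1) * (1 - t : ℂ) ^ (-Y - 1) := by
  have ht1 := one_sub_ofReal_ne_zero ht.2
  have hct : (1 - c * t : ℂ) ≠ 0 := mod_cast (one_sub_mul_pos hc ht.1.le ht.2).ne'
  rw [exp_primitive_mul hc ht, Complex.cpow_sub _ _ ht1, Complex.cpow_sub _ _ hct,
    Complex.cpow_one, Complex.cpow_one]
  simp only [omega, one_ne_zero, if_false]
  push_cast
  field_simp

/-- The generating function of the kernels `kernel c m n t`, in which `m` is marked by `X ^ m` and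
`n` by `Y ^ (n + 1)`. -/
def generatingKernel (c : ℝ) (X Y : ℂ) (t : ℝ) : ℂ :=
  (1 - c) * Y * (eulerKernel (1 - X) (1 - Y) t * (1 - c * t) ^ (-(1 - Y)))

theorem hasSum_kernel (hc : c < 1) (X Y : ℂ) {t : ℝ} (ht : t ∈ Ioo (0 : ℝ) 1) :
    HasSum (fun p : ℕ × ℕ => (kernel c (p.1 + 1) p.2 t : ℂ) * X ^ (p.1 + 1) * Y ^ (p.2 + 1))
      (generatingKernel c X Y t) := by
  have hlog := hasSum_pow_succ_div_factorial (Complex.log t * -X)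
  rw [← Complex.cpow_def_of_ne_zero (Complex.ofReal_ne_zero.2 ht.1.ne')] at hlog
  have hprim := hasSum_pow_div_factorial (primitive c t * Y)
  have hsummable := summable_mul_of_summable_norm hlog.summable.norm hprim.summable.norm
  convert! (hlog.mul hprim hsummable).mul_left ((omega c 1 t : ℂ) * Y) using 1
  · ext p
    rw [kernel, ← neg_mul_comm, ← Complex.ofReal_log ht.1.le, mul_pow, mul_pow]
    push_cast
    ring
  · rw [generatingKernel, eulerKernel, show 1 - Y - 2 = -Y - 1 by ring,
      show 1 - X - 1 = -X by ring, neg_sub]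
    linear_combination -Y * ((t : ℂ) ^ (-X) - 1) * omega_mul_exp_primitive_mul hc ht Y

theorem integrableOn_generatingKernel (hc : c < 1) {X Y : ℂ} (hX : X.re < 1) (hY : Y.re < 1) :
    IntegrableOn (generatingKernel c X Y) (Ioo 0 1) :=
  (integrableOn_mul_one_sub_mul_cpow
    (integrableOn_eulerKernel (by simpa using hX) (by simpa using hY))
    (ofReal_mem_cutPlane hc) _).const_mul _

theorem hasSum_kernel_re (hc : c < 1) (x y : ℝ) {t : ℝ} (ht : t ∈ Ioo (0 : ℝ) 1) :
    HasSum (fun p : ℕ × ℕ => kernel c (p.1 + 1) p.2 t * x ^ (p.1 + 1) * y ^ (p.2 + 1))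
      (generatingKernel c x y t).re := by
  convert! Complex.hasSum_re (hasSum_kernel hc x y ht) using 2 with p
  norm_cast

theorem integrableOn_kernel (hc : c < 1) (m n : ℕ) :
    IntegrableOn (kernel c (m + 1) n) (Ioo 0 1) := by
  have hterm : IntegrableOn
      (fun t => kernel c (m + 1) n t * (1 / 2) ^ (m + 1) * (1 / 2) ^ (n + 1)) (Ioo 0 1) := by
    refine (integrableOn_generatingKernel hc (X := (1 / 2 : ℝ)) (Y := (1 / 2 : ℝ))
      (by norm_num) (by norm_num)).re.mono'
      (((measurable_kernel c _ _).mul_const _).mul_const _).aestronglyMeasurable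
      (ae_restrict_of_forall_mem measurableSet_Ioo fun t ht => ?_)
    have hnonneg (p : ℕ × ℕ) :
        0 ≤ kernel c (p.1 + 1) p.2 t * (1 / 2 : ℝ) ^ (p.1 + 1) * (1 / 2 : ℝ) ^ (p.2 + 1) := by
      have := kernel_nonneg hc (p.1 + 1) p.2 ht
      positivity
    rw [Real.norm_of_nonneg (hnonneg (m, n))]
    exact le_hasSum (hasSum_kernel_re hc (1 / 2) (1 / 2) ht) (m, n) fun p _ => hnonneg p
  have hunit (k : ℕ) : IsUnit ((1 / 2 : ℝ) ^ k) := by simp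
  simpa [IntegrableOn, integrable_mul_const_iff, hunit] using hterm

theorem integral_generatingKernel (c : ℝ) (X Y : ℂ) :
    ∫ t in Ioo (0 : ℝ) 1, generatingKernel c X Y t =
      (1 - c) * Y * eulerIntegral (1 - X) (1 - Y) c :=
  integral_const_mul _ _

theorem hasSum_Z (hc : c < 1) {X Y : ℂ} (hX : ‖X‖ < 1) (hY : ‖Y‖ < 1) :
    HasSum (fun p : ℕ × ℕ =>
      (Z c (List.replicate p.2 1 ++ [p.1 + 2]) : ℂ) * X ^ (p.1 + 1) * Y ^ (p.2 + 1))
      ((1 - c) * Y * eulerIntegral (1 - X) (1 - Y) c) := by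
  have hbound {t : ℝ} (ht : t ∈ Ioo (0 : ℝ) 1) := hasSum_kernel_re hc ‖X‖ ‖Y‖ ht
  have hdominating : IntegrableOn (fun t : ℝ => ∑' p : ℕ × ℕ,
      kernel c (p.1 + 1) p.2 t * ‖X‖ ^ (p.1 + 1) * ‖Y‖ ^ (p.2 + 1)) (Ioo 0 1) :=
    IntegrableOn.congr_fun
      (integrableOn_generatingKernel hc (X := ‖X‖) (Y := ‖Y‖) hX hY).re
      (fun t ht => (hbound ht).tsum_eq.symm) measurableSet_Ioo
  have hsum := hasSum_integral_of_dominated_convergence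
    (μ := volume.restrict (Ioo (0 : ℝ) 1))
    (F := fun (p : ℕ × ℕ) t => (kernel c (p.1 + 1) p.2 t : ℂ) * X ^ (p.1 + 1) * Y ^ (p.2 + 1))
    (fun p t => kernel c (p.1 + 1) p.2 t * ‖X‖ ^ (p.1 + 1) * ‖Y‖ ^ (p.2 + 1))
    (fun p => (((measurable_kernel c _ _).complex_ofReal.mul_const _).mul_const
      _).aestronglyMeasurable)
    (fun p => ae_restrict_of_forall_mem measurableSet_Ioo fun t ht => ?_)
    (ae_restrict_of_forall_mem measurableSet_Ioo fun t ht => (hbound ht).summable) hdominating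
    (ae_restrict_of_forall_mem measurableSet_Ioo fun t ht => hasSum_kernel hc X Y ht)
  · rw [integral_generatingKernel] at hsum
    refine hsum.congr_fun fun p => ?_
    rw [integral_mul_const, integral_mul_const, integral_complex_ofReal,
      Z_eq_integral_kernel hc (p.1 + 1) p.2]
  · rw [norm_mul, norm_mul, norm_pow, norm_pow, Complex.norm_of_nonneg (kernel_nonneg hc _ _ ht)]

end GeneratingFunction

theorem one_sub_sub_ne_neg_natCast {X Y : ℂ} (hX : X.re < 1) (hY : Y.re < 1) (hXY : X + Y ≠ 1)
    (k : ℕ) : 1 - X - Y ≠ -k := by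
  rintro h
  obtain rfl | hk := k.eq_zero_or_pos
  · exact hXY (by linear_combination -h - Nat.cast_zero (R := ℂ))
  · have hre := congrArg Complex.re h
    have hk' : (1 : ℝ) ≤ k := mod_cast hk
    simp only [Complex.sub_re, Complex.one_re, Complex.neg_re, Complex.natCast_re] at hre
    linarith

end DeformedMZV

end

/-- The pair `p = (m - 1, n - 1)` runs over `ℕ × ℕ`, i.e. `m = p.1 + 1` and `n = p.2 + 1` run over
the positive integers. -/
theorem mainTheorem1 (c : ℝ) (hc : c < 1) :
    (∀ m n : ℕ, 1 ≤ m → 1 ≤ n →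
      MeasureTheory.IntegrableOn
        (DeformedMZV.integrand c (DeformedMZV.wordOf (List.replicate (n - 1) 1 ++ [m + 1])))
        (DeformedMZV.openSimplex
          (DeformedMZV.wordOf (List.replicate (n - 1) 1 ++ [m + 1])).length)) ∧
    ∀ X Y : ℂ, ‖X‖ < 1 → ‖Y‖ < 1 → X + Y ≠ 1 →
      Summable (fun p : ℕ × ℕ =>
        (DeformedMZV.Z c (List.replicate p.2 1 ++ [p.1 + 2]) : ℂ) *
          X ^ (p.1 + 1) * Y ^ (p.2 + 1)) ∧
      1 - ∑' p : ℕ × ℕ,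
        (DeformedMZV.Z c (List.replicate p.2 1 ++ [p.1 + 2]) : ℂ) *
          X ^ (p.1 + 1) * Y ^ (p.2 + 1) =
      (1 - (c : ℂ)) *
        (Complex.Gamma (1 - X) * Complex.Gamma (1 - Y) / Complex.Gamma (1 - X - Y)) *
        DeformedMZV.gaussHypergeometric (1 - X) (1 - Y) (1 - X - Y) (c : ℂ) := by
  refine ⟨fun m n hm _ => ?_, fun X Y hX hY hXY => ?_⟩
  · obtain ⟨m, rfl⟩ := Nat.exists_eq_add_of_le' hm
    exact DeformedMZV.integrableOn_integrand hc (DeformedMZV.integrableOn_kernel hc m (n - 1))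
  have hXre : X.re < 1 := (Complex.re_le_norm X).trans_lt hX
  have hYre : Y.re < 1 := (Complex.re_le_norm Y).trans_lt hY
  have hsum := DeformedMZV.hasSum_Z hc hX hY
  have hd : 1 - X + (1 - Y) - 1 = 1 - X - Y := by ring
  have hgauss := DeformedMZV.Gamma_mul_gaussHypergeometric (a := 1 - X) (b := 1 - Y)
    (by simpa using hXre) (by simpa using hYre)
    (hd ▸ DeformedMZV.one_sub_sub_ne_neg_natCast hXre hYre hXY)
    (DeformedMZV.ofReal_mem_cutPlane hc)
  rw [hd] at hgauss
  have hc' : (1 - c : ℂ) ≠ 0 := mod_cast (sub_pos.2 hc).ne'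
  refine ⟨hsum.summable, ?_⟩
  rw [hsum.tsum_eq]
  linear_combination -(1 - c : ℂ) * hgauss - mul_inv_cancel₀ hc'
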